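/- For every $c>0$ and $K>0$ there is a constant $C$, depending only on $c$ and $K$, such that the following holds. Let $A\in\mathbb{R}^{m\times n}$ have rank $s$, and let $0<\varepsilon\le 1$ (the machine error). Let $U^\varepsilon\in\mathbb{R}^{m\times n}$, $V^\varepsilon\in\mathbb{R}^{n\times n}$ and a diagonal matrix $\Sigma^\varepsilon\in\mathbb{R}^{n\times n}$ with nonnegative entries be a numerically computed reduced SVD of $A$ that is backward stable, that is, there are $\delta U,\delta A\in\mathbb{R}^{m\times n}$ and $\delta V\in\mathbb{R}^{n\times n}$ with $\|\delta U\|_2,\|\delta V\|_2,\|\delta A\|_2\le c\,\varepsilon$ such that $U^\varepsilon+\delta U$ and $V^\varepsilon+\delta V$ have orthonormal columns and $$(U^\varepsilon+\delta U)\,\Sigma^\varepsilon\,(V^\varepsilon+\delta V)^{*}=A+\delta A .$$ If $0<\eta\le K$ and the smallest nonzero singular value of $A$ satisfies $\sigma_s(A)\ge\eta$ (no condition if $s=0$), then the subdifferential at $A$ of the nuclear norm, $\partial\|A\|_*=\{G:\ \|B\|_*\ge\|A\|_*+\operatorname{tr}(G^{T}(B-A))\ \text{for all } B\in\mathbb{R}^{m\times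 n}\}$, is nonempty and $$\operatorname{dist}\bigl(U^\varepsilon V^{\varepsilon *},\,\partial\|A\|_*\bigr)\le C\,\frac{\varepsilon}{\eta},$$ where $\|\cdot\|_2$ is the spectral norm and the distance is taken in it. -/

import Mathlib

open scoped Matrix Matrix.Norms.L2Operator

noncomputable section

/-- The singular values of a real `m × n` matrix in decreasing order, repeated according to
multiplicity and indexed from `0` (so `matrixSingularValue A (s - 1)` is the `s`-th one); they
vanish from index `n` on. -/
def matrixSingularValue {m n : ℕ} (A : Matrix (Fin m) (Fin n) ℝ) (i : ℕ) : ℝ :=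
  (Matrix.toEuclideanLin A).singularValues i

/-- The nuclear norm: the sum of the singular values. -/
def nuclearNorm {m n : ℕ} (A : Matrix (Fin m) (Fin n) ℝ) : ℝ :=
  ∑ i ∈ Finset.range n, matrixSingularValue A i

/-- The subdifferential at `A` of a real function on `m × n` matrices, with respect to the
trace inner product `⟨G, B⟩ = tr (Gᵀ B)`. -/
def matrixSubdifferential {m n : ℕ} (f : Matrix (Fin m) (Fin n) ℝ → ℝ)
    (A : Matrix (Fin m) (Fin n) ℝ) : Set (Matrix (Fin m) (Fin n) ℝ) :=
  {G | ∀ B : Matrix (Fin m) (Fin n) ℝ, f A + (Gᵀ * (B - A)).trace ≤ f B}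

/-- `B = U Σ Vᵀ` is a reduced SVD: `U` (of size `m × n`) and `V` (of size `n × n`) have
orthonormal columns and `Σ` is the diagonal matrix of the numbers `σ i ≥ 0`. The order of the
`σ i` is left free. -/
structure IsReducedSVD {m n : ℕ} (B U : Matrix (Fin m) (Fin n) ℝ) (σ : Fin n → ℝ)
    (V : Matrix (Fin n) (Fin n) ℝ) : Prop where
  orthonormal_left : Uᵀ * U = 1
  orthonormal_right : Vᵀ * V = 1
  nonneg : ∀ i, 0 ≤ σ i
  eq : B = U * Matrix.diagonal σ * Vᵀ

/-- `(Uε, σε, Vε)` is a numerically computed reduced SVD of `A` that is backward stable with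
constant `c` at machine error `ε`: up to perturbations of spectral norm at most `c ε` of `Uε`,
`Vε` and `A`, it is an exact reduced SVD. Here `‖·‖` is the spectral norm. -/
def IsBackwardStableSVD {m n : ℕ} (c ε : ℝ) (A Uε : Matrix (Fin m) (Fin n) ℝ)
    (σε : Fin n → ℝ) (Vε : Matrix (Fin n) (Fin n) ℝ) : Prop :=
  ∃ (δU δA : Matrix (Fin m) (Fin n) ℝ) (δV : Matrix (Fin n) (Fin n) ℝ),
    ‖δU‖ ≤ c * ε ∧ ‖δV‖ ≤ c * ε ∧ ‖δA‖ ≤ c * ε ∧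
      IsReducedSVD (A + δA) (Uε + δU) σε (Vε + δV)

end

namespace Matrix

/-! The exact SVD of `A + D` gives `A + D = W * P` with `W = U * Vᵀ` isometric and `P = V * Σ * Vᵀ ≥
0`, so the claim is a perturbation bound for polar factors. Compare with the polar decomposition `A
= Q * H`, where `Q` is a partial isometry and `E = Qᵀ * Q`. The defect `T = E - Qᵀ * W` solves a
Sylvester equation `H * T + T * P = F` with `‖F‖ ≤ 2 * ‖D‖`. Since `H ≥ η * E` and `P ≥ 0`,
`mul_l2_opNorm_le_of_sylvester` gives `‖T‖ ≤ 2 * ‖D‖ / η`; no gap in the spectrum of `A + D` is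
needed. Keeping `Q` and the block of `W` from `ker A` to `(range A)ᗮ` gives a subgradient, and the
rest of `W` is controlled by `T` and `D`. Replacing `U`, `V` by the computed factors costs a further
`O(ε)`. -/

theorem l2_opNorm_transpose {m n : ℕ} (A : Matrix (Fin m) (Fin n) ℝ) : ‖Aᵀ‖ = ‖A‖ := by
  rw [← conjTranspose_eq_transpose_of_trivial, l2_opNorm_conjTranspose]

/-- The hypothesis says `‖G x‖² + ‖N x‖² = ‖x‖²`. `N` serves as an explicit certificate that `1 - Gᵀ
* G` is positive semidefinite. -/
theorem l2_opNorm_le_one_of_add_eq_one {k m n : ℕ} {G : Matrix (Fin m) (Fin n) ℝ}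
    {N : Matrix (Fin k) (Fin n) ℝ} (h : Gᵀ * G + Nᵀ * N = 1) : ‖G‖ ≤ 1 := by
  have key : ∀ x : Fin n → ℝ,
      (G *ᵥ x) ⬝ᵥ (G *ᵥ x) + (N *ᵥ x) ⬝ᵥ (N *ᵥ x) = x ⬝ᵥ x := by
    intro x
    have := congrArg (fun M => x ⬝ᵥ (M *ᵥ x)) h
    simpa [add_mulVec, dotProduct_add, ← mulVec_mulVec, dotProduct_mulVec,
      vecMul_transpose] using this
  rw [l2_opNorm_def]
  refine ContinuousLinearMap.opNorm_le_bound _ zero_le_one fun x => ?_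
  rw [one_mul]
  refine le_of_sq_le_sq ?_ (norm_nonneg _)
  have h1 : ∀ (p : ℕ) (y : EuclideanSpace ℝ (Fin p)), ‖y‖ ^ 2 = y.ofLp ⬝ᵥ y.ofLp := by
    intro p y
    rw [EuclideanSpace.norm_sq_eq]
    simp [dotProduct, sq]
  have h2 : 0 ≤ (N *ᵥ x.ofLp) ⬝ᵥ (N *ᵥ x.ofLp) :=
    Finset.sum_nonneg fun i _ => mul_self_nonneg _
  rw [h1, h1, ← key]
  change (G *ᵥ x.ofLp) ⬝ᵥ (G *ᵥ x.ofLp) ≤ _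
  linarith

theorem l2_opNorm_le_one_of_transpose_mul_self {m n : ℕ} {G : Matrix (Fin m) (Fin n) ℝ}
    (h : Gᵀ * G = 1) : ‖G‖ ≤ 1 :=
  l2_opNorm_le_one_of_add_eq_one (N := (0 : Matrix (Fin 0) (Fin n) ℝ)) (by simpa using h)

theorem diag_le_l2_opNorm {n : ℕ} (M : Matrix (Fin n) (Fin n) ℝ) (i : Fin n) :
    M i i ≤ ‖M‖ := by
  have h := l2_opNorm_mulVec M (EuclideanSpace.single i (1 : ℝ))
  have h' := PiLp.norm_apply_le (WithLp.toLp 2 (M *ᵥ (EuclideanSpace.single i (1 : ℝ)).ofLp)) i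
  simp at h h'
  exact (le_abs_self _).trans (h'.trans h)

theorem diag_transpose_mul_diagonal_mul_nonneg {n k : ℕ} {d : Fin n → ℝ} (hd : ∀ i, 0 ≤ d i)
    (X : Matrix (Fin n) (Fin k) ℝ) (i : Fin k) : 0 ≤ (Xᵀ * diagonal d * X) i i := by
  rw [mul_apply]
  refine Finset.sum_nonneg fun j _ => ?_
  rw [mul_diagonal, transpose_apply]
  nlinarith [hd j, mul_self_nonneg (X j i), mul_nonneg (hd j) (mul_self_nonneg (X j i))]

/-! ### Singular value decomposition. -/

theorem exists_orthogonal_diagonalization_gram {m n : ℕ} (A : Matrix (Fin m) (Fin n) ℝ) :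
    ∃ V : Matrix (Fin n) (Fin n) ℝ, Vᵀ * V = 1 ∧
      Vᵀ * (Aᵀ * A) * V = diagonal fun i : Fin n => matrixSingularValue A i ^ 2 := by
  set T := toEuclideanLin A with hT
  have hn : Module.finrank ℝ (EuclideanSpace ℝ (Fin n)) = n := by simp
  obtain ⟨b, hb⟩ : ∃ b : OrthonormalBasis (Fin n) ℝ (EuclideanSpace ℝ (Fin n)),
      ∀ i, (LinearMap.adjoint T ∘ₗ T) (b i) = (T.singularValues i ^ 2) • b i := by
    refine ⟨T.isSymmetric_adjoint_comp_self.eigenvectorBasis hn, fun i => ?_⟩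
    rw [T.sq_singularValues_fin hn i]
    exact T.isSymmetric_adjoint_comp_self.apply_eigenvectorBasis hn i
  have hb1 : ∀ i, (Aᵀ * A) *ᵥ (b i).ofLp = matrixSingularValue A i ^ 2 • (b i).ofLp := by
    intro i
    have h := hb i
    rw [hT, ← toEuclideanLin_conjTranspose_eq_adjoint] at h
    have h' := congrArg WithLp.ofLp h
    rw [conjTranspose_eq_transpose_of_trivial] at h'
    rw [← mulVec_mulVec]
    exact h'
  have hb2 : ∀ i j, (b i).ofLp ⬝ᵥ (b j).ofLp = if i = j then 1 else 0 := by
    intro i j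
    rw [← orthonormal_iff_ite.mp b.orthonormal i j, PiLp.inner_apply]
    exact Finset.sum_congr rfl fun k _ => mul_comm _ _
  refine ⟨of fun k i => b i k, ?_, ?_⟩
  · ext i j
    rw [one_apply, ← hb2]
    rfl
  · ext i j
    rw [Matrix.mul_assoc, diagonal_apply]
    have : ∀ k, ((Aᵀ * A) * of fun k i => b i k) k j = matrixSingularValue A j ^ 2 * b j k :=
      fun k => congrFun (hb1 j) k
    rw [mul_apply]
    simp only [this, transpose_apply, of_apply]
    have h3 := hb2 i j
    rw [dotProduct] at h3
    calc _ = matrixSingularValue A j ^ 2 * ∑ k, b i k * b j k := by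
          rw [Finset.mul_sum]; exact Finset.sum_congr rfl fun k _ => by ring
      _ = _ := by rw [h3]; split_ifs with h <;> simp [h]

theorem eq_zero_of_transpose_mul_self {m n : ℕ} {A : Matrix (Fin m) (Fin n) ℝ}
    (h : Aᵀ * A = 0) : A = 0 := by
  rw [← conjTranspose_eq_transpose_of_trivial] at h
  exact conjTranspose_mul_self_eq_zero.mp h

/-- `Y` normalises the columns of `A * V` and, as `0⁻¹ = 0`, has zero columns where the singular
value vanishes. Not completing `Y` to an isometry makes this valid for `m < n` too. -/
theorem exists_svd {m n : ℕ} (A : Matrix (Fin m) (Fin n) ℝ) :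
    ∃ (Y : Matrix (Fin m) (Fin n) ℝ) (V : Matrix (Fin n) (Fin n) ℝ),
      Vᵀ * V = 1 ∧ V * Vᵀ = 1 ∧
      Yᵀ * Y = diagonal (fun i : Fin n => if matrixSingularValue A i = 0 then 0 else 1) ∧
      A = Y * diagonal (fun i : Fin n => matrixSingularValue A i) * Vᵀ ∧
      Y = A * V * diagonal (fun i : Fin n => (matrixSingularValue A i)⁻¹) := by
  obtain ⟨V, hV, hA⟩ := exists_orthogonal_diagonalization_gram A
  have hV' : V * Vᵀ = 1 := mul_eq_one_comm.mp hV
  set σ : Fin n → ℝ := fun i => matrixSingularValue A i with hσ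
  have hA' : (A * V)ᵀ * (A * V) = diagonal fun i => σ i ^ 2 := by
    rw [transpose_mul, ← hA]; simp only [Matrix.mul_assoc]
  refine ⟨A * V * diagonal (fun i => (σ i)⁻¹), V, hV, hV', ?_, ?_, rfl⟩
  · rw [transpose_mul, diagonal_transpose, Matrix.mul_assoc, ← Matrix.mul_assoc (A * V)ᵀ, hA',
      diagonal_mul_diagonal, diagonal_mul_diagonal]
    congr 1
    ext i
    by_cases h : σ i = 0
    · simp [h, show matrixSingularValue A i = 0 from h]
    · rw [if_neg (show ¬ matrixSingularValue A i = 0 from h)]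
      field_simp
  -- The Gram matrix of this residual is diagonal with entries `σ² * (1 - σ⁻¹ * σ)²`, all zero.
  · have h : A * V * (1 - diagonal fun i => (σ i)⁻¹ * σ i) = 0 := by
      apply eq_zero_of_transpose_mul_self
      rw [transpose_mul, Matrix.mul_assoc, ← Matrix.mul_assoc (A * V)ᵀ, hA', ← diagonal_one,
        diagonal_sub, diagonal_transpose, diagonal_mul_diagonal, diagonal_mul_diagonal,
        diagonal_eq_zero]
      ext i
      by_cases h : σ i = 0
      · simp [h]
      · simp [h]
    rw [Matrix.mul_sub, Matrix.mul_one, sub_eq_zero] at h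
    rw [Matrix.mul_assoc (A * V), diagonal_mul_diagonal, ← h, Matrix.mul_assoc, hV',
      Matrix.mul_one]

/-! ### Nuclear norm and its subgradients. -/

theorem matrixSingularValue_nonneg {m n : ℕ} (A : Matrix (Fin m) (Fin n) ℝ) (i : ℕ) :
    0 ≤ matrixSingularValue A i :=
  LinearMap.singularValues_nonneg _ i

theorem nuclearNorm_eq_trace {m n : ℕ} (A : Matrix (Fin m) (Fin n) ℝ) :
    nuclearNorm A = (diagonal fun i : Fin n => matrixSingularValue A i).trace := by
  rw [trace_diagonal, nuclearNorm, Finset.sum_range]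

/-- With `B = Y * Σ * Vᵀ`, the trace is the sum of the `σ i` weighted by the diagonal of the
contraction `Vᵀ * Gᵀ * Y`. -/
theorem trace_transpose_mul_le_nuclearNorm {m n : ℕ} {G : Matrix (Fin m) (Fin n) ℝ}
    (hG : ‖G‖ ≤ 1) (B : Matrix (Fin m) (Fin n) ℝ) : (Gᵀ * B).trace ≤ nuclearNorm B := by
  obtain ⟨Y, V, hV, -, hY, hB, -⟩ := exists_svd B
  have hY1 : ‖Y‖ ≤ 1 := by
    refine l2_opNorm_le_one_of_add_eq_one
      (N := diagonal fun i : Fin n => if matrixSingularValue B i = 0 then (1 : ℝ) else 0) ?_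
    rw [hY, diagonal_transpose, diagonal_mul_diagonal, diagonal_add, ← diagonal_one]
    congr 1
    ext i
    split_ifs <;> simp
  have hV1 : ‖V‖ ≤ 1 := l2_opNorm_le_one_of_transpose_mul_self hV
  have hM : ‖Vᵀ * (Gᵀ * Y)‖ ≤ 1 := by
    refine (l2_opNorm_mul _ _).trans (mul_le_one₀ ?_ (norm_nonneg _)
      ((l2_opNorm_mul _ _).trans (mul_le_one₀ ?_ (norm_nonneg _) hY1)))
    · rwa [l2_opNorm_transpose]
    · rwa [l2_opNorm_transpose]
  calc (Gᵀ * B).trace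
      = (Vᵀ * (Gᵀ * Y) * diagonal fun i : Fin n => matrixSingularValue B i).trace := by
        conv_lhs => rw [hB]
        rw [← Matrix.mul_assoc, trace_mul_comm]
        simp only [Matrix.mul_assoc]
    _ ≤ nuclearNorm B := by
        rw [nuclearNorm_eq_trace]
        refine Finset.sum_le_sum fun i _ => ?_
        rw [diag_apply, diag_apply, mul_diagonal, diagonal_apply_eq]
        exact mul_le_of_le_one_left (matrixSingularValue_nonneg B i)
          ((diag_le_l2_opNorm _ i).trans hM)

theorem mem_matrixSubdifferential_nuclearNorm {m n : ℕ} {A G : Matrix (Fin m) (Fin n) ℝ}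
    (hG : ‖G‖ ≤ 1) (hA : (Gᵀ * A).trace = nuclearNorm A) :
    G ∈ matrixSubdifferential nuclearNorm A := by
  intro B
  rw [Matrix.mul_sub, trace_sub, hA]
  linarith [trace_transpose_mul_le_nuclearNorm hG B]

/-! ### Sylvester estimate and polar decomposition. -/

/-- A Sylvester equation `H T + T P = F` with `P ≥ 0` and `H ≥ η E` on a subspace containing the
range of `T` determines `T` up to `‖F‖ / η`. -/
theorem mul_l2_opNorm_le_of_sylvester {n : ℕ} {T H P E F : Matrix (Fin n) (Fin n) ℝ} {η : ℝ}
    (hη : 0 < η) (hH : ∀ (X : Matrix (Fin n) (Fin n) ℝ) i, η * (Xᵀ * E * X) i i ≤ (Xᵀ * H * X) i i)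
    (hP : ∀ (X : Matrix (Fin n) (Fin n) ℝ) i, 0 ≤ (Xᵀ * P * X) i i)
    (hE : E * T = T) (hF : H * T + T * P = F) : η * ‖T‖ ≤ ‖F‖ := by
  obtain ⟨Y, V, hV, -, hY, hT, hYT⟩ := exists_svd T
  set σ : Fin n → ℝ := fun i => matrixSingularValue T i with hσ
  have hY1 : ‖Y‖ ≤ 1 := by
    refine l2_opNorm_le_one_of_add_eq_one
      (N := diagonal fun i : Fin n => if matrixSingularValue T i = 0 then (1 : ℝ) else 0) ?_
    rw [hY, diagonal_transpose, diagonal_mul_diagonal, diagonal_add, ← diagonal_one]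
    congr 1
    ext i
    split_ifs <;> simp
  have hV1 : ‖V‖ ≤ 1 := l2_opNorm_le_one_of_transpose_mul_self hV
  have hEY : E * Y = Y := by
    rw [hYT, ← Matrix.mul_assoc, ← Matrix.mul_assoc, hE]
  have hTV : T * V = Y * diagonal σ := by
    conv_lhs => rw [hT]
    rw [Matrix.mul_assoc, hV, Matrix.mul_one]
  have hYTσ : Yᵀ * T = diagonal σ * Vᵀ := by
    conv_lhs => rw [hT]
    rw [← Matrix.mul_assoc, ← Matrix.mul_assoc, hY, diagonal_mul_diagonal]
    congr 2
    ext i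
    by_cases h : matrixSingularValue T i = 0 <;> simp [h, hσ]
  have hFeq : Yᵀ * F * V = Yᵀ * H * Y * diagonal σ + diagonal σ * (Vᵀ * P * V) := by
    rw [← hF, Matrix.mul_add, Matrix.add_mul]
    congr 1
    · simp only [Matrix.mul_assoc, hTV]
    · simp only [← Matrix.mul_assoc, hYTσ]
  have hF1 : ‖Yᵀ * F * V‖ ≤ ‖F‖ := by
    refine (l2_opNorm_mul _ _).trans ((mul_le_of_le_one_right (norm_nonneg _) hV1).trans
      ((l2_opNorm_mul _ _).trans (mul_le_of_le_one_left (norm_nonneg _) ?_)))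
    rwa [l2_opNorm_transpose]
  have hbound : ∀ i, η * σ i ≤ ‖F‖ := by
    intro i
    by_cases h : matrixSingularValue T i = 0
    · simp [hσ, h]
    -- Testing the equation on a pair of singular vectors of `T` gives `σ i * ((Yᵀ * H * Y) i i +
    -- (Vᵀ * P * V) i i)`, and the bracket is at least `η`.
    · have h1 := (diag_le_l2_opNorm _ i).trans hF1
      rw [hFeq, add_apply, mul_diagonal, diagonal_mul] at h1
      have h2 := hH Y i
      rw [Matrix.mul_assoc, hEY, hY, diagonal_apply_eq, if_neg h, mul_one] at h2
      have h0 : 0 ≤ σ i := matrixSingularValue_nonneg T i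
      nlinarith [mul_le_mul_of_nonneg_right h2 h0, mul_nonneg h0 (hP V i)]
  have hT1 : ‖T‖ ≤ ‖diagonal σ‖ := by
    conv_lhs => rw [hT]
    refine (l2_opNorm_mul _ _).trans ((mul_le_of_le_one_right (norm_nonneg _) ?_).trans
      ((l2_opNorm_mul _ _).trans (mul_le_of_le_one_left (norm_nonneg _) hY1)))
    rwa [l2_opNorm_transpose]
  have hσ1 : ‖diagonal σ‖ ≤ ‖F‖ / η := by
    rw [l2_opNorm_diagonal, pi_norm_le_iff_of_nonneg (by positivity)]
    intro i
    rw [Real.norm_of_nonneg (matrixSingularValue_nonneg T i), le_div_iff₀ hη, mul_comm]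
    exact hbound i
  rw [mul_comm, ← le_div_iff₀ hη]
  exact hT1.trans hσ1

/-- The polar decomposition `A = Q H`, with `E` the orthogonal projection onto the row space and
`J` the pseudoinverse of `H`. -/
theorem exists_polar {m n : ℕ} (A : Matrix (Fin m) (Fin n) ℝ) {η : ℝ} (hη : 0 < η)
    (hA : ∀ i : Fin n, matrixSingularValue A i ≠ 0 → η ≤ matrixSingularValue A i) :
    ∃ (Q : Matrix (Fin m) (Fin n) ℝ) (H J E : Matrix (Fin n) (Fin n) ℝ),
      A = Q * H ∧ Q = A * J ∧ Qᵀ * Q = E ∧ Q * E = Q ∧ Hᵀ = H ∧ E * H = H ∧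
      Eᵀ = E ∧ E * E = E ∧ ‖J‖ ≤ η⁻¹ ∧ H.trace = nuclearNorm A ∧
      ∀ (X : Matrix (Fin n) (Fin n) ℝ) i, η * (Xᵀ * E * X) i i ≤ (Xᵀ * H * X) i i := by
  obtain ⟨Y, V, hV, hV', hY, hAY, hYA⟩ := exists_svd A
  set σ : Fin n → ℝ := fun i => matrixSingularValue A i with hσ
  set e : Fin n → ℝ := fun i => if matrixSingularValue A i = 0 then 0 else 1 with he
  have hV1 : ‖V‖ ≤ 1 := l2_opNorm_le_one_of_transpose_mul_self hV
  have hcanc : ∀ {k : ℕ} (M : Matrix (Fin n) (Fin k) ℝ), Vᵀ * (V * M) = M := fun M => by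
    rw [← Matrix.mul_assoc, hV, Matrix.one_mul]
  have heσ : diagonal e * diagonal σ = diagonal σ := by
    rw [diagonal_mul_diagonal]
    congr 1
    ext i
    by_cases h : matrixSingularValue A i = 0 <;> simp [h, hσ, he]
  have hee : diagonal e * diagonal e = diagonal e := by
    rw [diagonal_mul_diagonal]
    congr 1
    ext i
    by_cases h : matrixSingularValue A i = 0 <;> simp [h, he]
  have hYe : Y * diagonal e = Y := by
    rw [hYA, Matrix.mul_assoc _ _ (diagonal e), diagonal_mul_diagonal]
    congr 2
    ext i
    by_cases h : matrixSingularValue A i = 0 <;> simp [h, he]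
  have hmul : ∀ {k : ℕ} (M : Matrix (Fin k) (Fin n) ℝ) (D D' : Matrix (Fin n) (Fin n) ℝ),
      M * D * Vᵀ * (V * D' * Vᵀ) = M * (D * D') * Vᵀ := fun M D D' => by
    simp only [Matrix.mul_assoc, hcanc]
  refine ⟨Y * Vᵀ, V * diagonal σ * Vᵀ, V * diagonal (fun i => (σ i)⁻¹) * Vᵀ,
    V * diagonal e * Vᵀ, ?_, ?_, ?_, ?_, ?_, ?_, ?_, ?_, ?_, ?_, ?_⟩
  · simp only [Matrix.mul_assoc, hcanc]
    simpa only [Matrix.mul_assoc] using hAY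
  · conv_lhs => rw [hYA]
    simp only [Matrix.mul_assoc]
    rfl
  · rw [transpose_mul, transpose_transpose, Matrix.mul_assoc, ← Matrix.mul_assoc Yᵀ, hY,
      Matrix.mul_assoc]
  · simp only [Matrix.mul_assoc, hcanc]
    rw [← Matrix.mul_assoc, hYe]
  · simp [transpose_mul, Matrix.mul_assoc]
  · rw [hmul, heσ]
  · simp [transpose_mul, Matrix.mul_assoc]
  · rw [hmul, hee]
  · refine (l2_opNorm_mul _ _).trans ((mul_le_of_le_one_right (norm_nonneg _) ?_).trans
      ((l2_opNorm_mul _ _).trans ((mul_le_of_le_one_left (norm_nonneg _) hV1).trans ?_)))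
    · rwa [l2_opNorm_transpose]
    · rw [l2_opNorm_diagonal, pi_norm_le_iff_of_nonneg (by positivity)]
      intro i
      rw [Real.norm_of_nonneg (inv_nonneg.mpr (matrixSingularValue_nonneg A i))]
      by_cases h : matrixSingularValue A i = 0
      · simp [h, hη.le]
      · exact inv_anti₀ hη (hA i h)
  · rw [trace_mul_comm, ← Matrix.mul_assoc, hV, Matrix.one_mul, nuclearNorm_eq_trace]
  · intro X i
    have h := diag_transpose_mul_diagonal_mul_nonneg (d := fun i => σ i - η * e i) (fun i => by
      by_cases h : matrixSingularValue A i = 0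
      · simp [hσ, he, h]
      · simpa [hσ, he, h] using hA i h) (Vᵀ * X) i
    have hd : diagonal (fun i => σ i - η * e i) = diagonal σ - η • diagonal e := by
      rw [← diagonal_smul, diagonal_sub]
      rfl
    rw [hd, Matrix.mul_sub, Matrix.sub_mul, Matrix.mul_smul, Matrix.smul_mul, sub_apply,
      smul_apply, smul_eq_mul, transpose_mul, transpose_transpose] at h
    simp only [Matrix.mul_assoc] at h ⊢
    linarith

/-! ### Perturbation of the polar factor. -/

theorem l2_opNorm_projection_le_one {n : ℕ} {R : Matrix (Fin n) (Fin n) ℝ} (hR : Rᵀ = R)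
    (hRR : R * R = R) : ‖R‖ ≤ 1 ∧ ‖1 - R‖ ≤ 1 := by
  have h : Rᵀ * R + (1 - R)ᵀ * (1 - R) = 1 := by
    rw [transpose_sub, transpose_one, hR]
    noncomm_ring
    simp [hRR]
  exact ⟨l2_opNorm_le_one_of_add_eq_one h, l2_opNorm_le_one_of_add_eq_one ((add_comm _ _).trans h)⟩

theorem l2_opNorm_mul_le_of_le_one_left {k m n : ℕ} {A : Matrix (Fin k) (Fin m) ℝ}
    (hA : ‖A‖ ≤ 1) (B : Matrix (Fin m) (Fin n) ℝ) : ‖A * B‖ ≤ ‖B‖ :=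
  (l2_opNorm_mul A B).trans (mul_le_of_le_one_left (norm_nonneg _) hA)

theorem l2_opNorm_mul_le_of_le_one_right {k m n : ℕ} (A : Matrix (Fin k) (Fin m) ℝ)
    {B : Matrix (Fin m) (Fin n) ℝ} (hB : ‖B‖ ≤ 1) : ‖A * B‖ ≤ ‖A‖ :=
  (l2_opNorm_mul A B).trans (mul_le_of_le_one_right (norm_nonneg _) hB)

/-- The isometric polar factor `W` of a perturbation `A + D` of `A` is close to the
subdifferential of the nuclear norm at `A`. -/
theorem exists_mem_matrixSubdifferential_norm_sub_le {m n : ℕ}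
    {A D W : Matrix (Fin m) (Fin n) ℝ} {P : Matrix (Fin n) (Fin n) ℝ} {η : ℝ} (hη : 0 < η)
    (hA : ∀ i : Fin n, matrixSingularValue A i ≠ 0 → η ≤ matrixSingularValue A i)
    (hW : Wᵀ * W = 1) (hPt : Pᵀ = P)
    (hP : ∀ (X : Matrix (Fin n) (Fin n) ℝ) i, 0 ≤ (Xᵀ * P * X) i i)
    (hAD : A + D = W * P) :
    ∃ G ∈ matrixSubdifferential nuclearNorm A, ‖W - G‖ ≤ 5 * (‖D‖ / η) := by
  obtain ⟨Q, H, J, E, hAQ, hQJ, hQQ, hQE, hHt, hEH, hEt, hEE, hJ, htr, hH⟩ := exists_polar A hη hA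
  have hA' : A = W * P - D := eq_sub_of_add_eq hAD
  have hEQ : E * Qᵀ = Qᵀ := by
    rw [← hEt, ← transpose_mul, hQE]
  have hHE : H * E = H := by
    have := congrArg transpose hEH
    rwa [transpose_mul, hHt, hEt] at this
  have hW1 : ‖W‖ ≤ 1 := l2_opNorm_le_one_of_transpose_mul_self hW
  obtain ⟨hE1, -⟩ := l2_opNorm_projection_le_one hEt hEE
  have hQ1 : ‖Q‖ ≤ 1 := by
    refine l2_opNorm_le_one_of_add_eq_one (N := 1 - E) ?_
    rw [hQQ, transpose_sub, transpose_one, hEt]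
    noncomm_ring
    simp [hEE]
  have hQt1 : ‖Qᵀ‖ ≤ 1 := by rwa [l2_opNorm_transpose]
  have hRt : (Q * Qᵀ)ᵀ = Q * Qᵀ := by rw [transpose_mul, transpose_transpose]
  have hRQ : Q * Qᵀ * Q = Q := by rw [Matrix.mul_assoc, hQQ, hQE]
  have hRR : Q * Qᵀ * (Q * Qᵀ) = Q * Qᵀ := by rw [← Matrix.mul_assoc, hRQ]
  obtain ⟨-, hS1⟩ := l2_opNorm_projection_le_one hRt hRR
  obtain ⟨-, hWW1⟩ := l2_opNorm_projection_le_one (R := W * Wᵀ)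
    (by rw [transpose_mul, transpose_transpose])
    (by rw [Matrix.mul_assoc, ← Matrix.mul_assoc Wᵀ, hW, Matrix.one_mul])
  set S := 1 - Q * Qᵀ with hS
  have hSt : Sᵀ = S := by rw [hS, transpose_sub, transpose_one, hRt]
  have hSQ : S * Q = 0 := by rw [hS, Matrix.sub_mul, hRQ, Matrix.one_mul, sub_self]
  have hSA : S * A = 0 := by rw [hAQ, ← Matrix.mul_assoc, hSQ, Matrix.zero_mul]
  have hAtW : Aᵀ * W = P - Dᵀ * W := by
    rw [hA', transpose_sub, transpose_mul, hPt, Matrix.sub_mul, Matrix.mul_assoc, hW,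
      Matrix.mul_one]
  set T := E - Qᵀ * W with hT
  have hET : E * T = T := by
    rw [hT, Matrix.mul_sub, hEE, ← Matrix.mul_assoc, hEQ]
  have hHT : H * T = H - P + Dᵀ * W := by
    have : H * Qᵀ = Aᵀ := by rw [hAQ, transpose_mul, hHt]
    rw [hT, Matrix.mul_sub, hHE, ← Matrix.mul_assoc, this, hAtW]
    abel
  have hTP : T * P = E * P - H - Qᵀ * D := by
    have : Qᵀ * A = H := by rw [hAQ, ← Matrix.mul_assoc, hQQ, hEH]
    rw [hT, Matrix.sub_mul, Matrix.mul_assoc, ← hAD, Matrix.mul_add, this]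
    abel
  -- The sum is `E * P - P + Dᵀ * W - Qᵀ * D`. It is fixed by `E`, and `E` kills `E * P - P`.
  have hsyl : H * T + T * P = E * (Dᵀ * W - Qᵀ * D) := by
    have h1 : E * (H * T + T * P) = H * T + T * P := by
      rw [Matrix.mul_add, ← Matrix.mul_assoc, ← Matrix.mul_assoc, hEH, hET]
    rw [← h1, hHT, hTP]
    simp only [Matrix.mul_add, Matrix.mul_sub, ← Matrix.mul_assoc, hEE]
    abel
  have hT1 : ‖T‖ ≤ 2 * (‖D‖ / η) := by
    have h := mul_l2_opNorm_le_of_sylvester hη hH hP hET hsyl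
    have h1 : ‖Dᵀ * W‖ ≤ ‖D‖ :=
      (l2_opNorm_mul_le_of_le_one_right _ hW1).trans_eq (l2_opNorm_transpose D)
    have h2 : ‖Qᵀ * D‖ ≤ ‖D‖ := l2_opNorm_mul_le_of_le_one_left hQt1 _
    have h3 := (l2_opNorm_mul_le_of_le_one_left hE1 _).trans (norm_sub_le (Dᵀ * W) (Qᵀ * D))
    rw [← mul_div_assoc, le_div_iff₀ hη]
    linarith
  -- `S` and `1 - E` project onto the orthogonal complements of the column and row spaces of `A`.
  -- The second summand is thus orthogonal to `A`, and `Qᵀ * W * (1 - E)` is the part of `W * (1 -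
  -- E)` that `S` discards.
  refine ⟨Q + S * W * (1 - E), mem_matrixSubdifferential_nuclearNorm ?_ ?_, ?_⟩
  · refine l2_opNorm_le_one_of_add_eq_one (N := Qᵀ * W * (1 - E)) ?_
    have hQS : Qᵀ * S = 0 := by
      rw [← hSt, ← transpose_mul, hSQ, transpose_zero]
    have hSS : S * S = S := by
      conv_lhs => rw [hS]
      rw [Matrix.sub_mul, Matrix.one_mul, Matrix.mul_assoc, hQS, Matrix.mul_zero, sub_zero]
    have hEt' : (1 - E)ᵀ = 1 - E := by rw [transpose_sub, transpose_one, hEt]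
    have hEE' : (1 - E) * (1 - E) = 1 - E := by
      simp [Matrix.sub_mul, Matrix.mul_sub, hEE]
    have h1 : Qᵀ * (S * W * (1 - E)) = 0 := by
      rw [Matrix.mul_assoc, ← Matrix.mul_assoc, hQS, Matrix.zero_mul]
    have h2 : (S * W * (1 - E))ᵀ * Q = 0 := by
      rw [← transpose_transpose Q, ← transpose_mul, h1, transpose_zero]
    have h3 : (S * W * (1 - E))ᵀ * (S * W * (1 - E)) = (1 - E) * (Wᵀ * S * W) * (1 - E) := by
      rw [transpose_mul, transpose_mul, hSt, hEt']
      simp only [Matrix.mul_assoc]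
      rw [← Matrix.mul_assoc S S, hSS]
    have h4 : (Qᵀ * W * (1 - E))ᵀ * (Qᵀ * W * (1 - E))
        = (1 - E) * (Wᵀ * (Q * Qᵀ) * W) * (1 - E) := by
      rw [transpose_mul, transpose_mul, hEt', transpose_transpose]
      simp only [Matrix.mul_assoc]
    have h5 : Wᵀ * S * W + Wᵀ * (Q * Qᵀ) * W = 1 := by
      rw [← Matrix.add_mul, ← Matrix.mul_add, hS, sub_add_cancel, Matrix.mul_one, hW]
    rw [transpose_add, Matrix.add_mul, Matrix.mul_add, Matrix.mul_add, h1, h2, h3, hQQ, h4,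
      zero_add, add_zero, add_assoc, ← Matrix.add_mul, ← Matrix.mul_add, h5, Matrix.mul_one, hEE',
      add_sub_cancel]
  · have h1 : (S * W * (1 - E))ᵀ * A = 0 := by
      rw [Matrix.mul_assoc, transpose_mul, hSt, Matrix.mul_assoc, hSA, Matrix.mul_zero]
    rw [transpose_add, Matrix.add_mul, h1, add_zero, ← htr]
    congr 1
    rw [hAQ, ← Matrix.mul_assoc, hQQ, hEH]
  · have hTt : E = Tᵀ + Wᵀ * Q := by
      rw [hT, transpose_sub, hEt, transpose_mul, transpose_transpose, sub_add_cancel]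
    have hWA : W * Wᵀ * A = A + (1 - W * Wᵀ) * D := by
      have : W * Wᵀ * (A + D) = A + D := by
        rw [hAD, Matrix.mul_assoc, ← Matrix.mul_assoc Wᵀ, hW, Matrix.one_mul]
      rw [Matrix.mul_add] at this
      rw [eq_sub_of_add_eq this, Matrix.sub_mul, Matrix.one_mul]
      abel
    -- As `Q = A * J` and `S * A = 0`, only the part of `D` outside the range of `W` survives.
    have hSWQ : S * W * (Wᵀ * Q) = S * ((1 - W * Wᵀ) * D) * J := by
      have : S * (W * Wᵀ * A) = S * ((1 - W * Wᵀ) * D) := by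
        rw [hWA, Matrix.mul_add, hSA, zero_add]
      rw [← this]
      conv_lhs => rw [hQJ]
      simp only [Matrix.mul_assoc]
    have hdecomp : W - (Q + S * W * (1 - E))
        = -(Q * T) + S * W * Tᵀ + S * ((1 - W * Wᵀ) * D) * J := by
      have h1 : S * W * E = S * W * Tᵀ + S * ((1 - W * Wᵀ) * D) * J := by
        conv_lhs => rw [hTt]
        rw [Matrix.mul_add, hSWQ]
      have h2 : Q * T = Q - W + S * W := by
        rw [hT, hS, Matrix.mul_sub, hQE, Matrix.sub_mul, Matrix.one_mul, ← Matrix.mul_assoc]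
        abel
      rw [add_assoc, ← h1, h2, Matrix.mul_sub, Matrix.mul_one]
      abel
    have n1 : ‖-(Q * T)‖ ≤ ‖T‖ := by
      rw [norm_neg]
      exact l2_opNorm_mul_le_of_le_one_left hQ1 _
    have n2 : ‖S * W * Tᵀ‖ ≤ ‖T‖ :=
      (l2_opNorm_mul_le_of_le_one_left
        ((l2_opNorm_mul_le_of_le_one_left hS1 _).trans hW1) _).trans_eq (l2_opNorm_transpose T)
    have n3 : ‖S * ((1 - W * Wᵀ) * D) * J‖ ≤ ‖D‖ / η := by
      refine (l2_opNorm_mul _ _).trans ?_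
      rw [div_eq_mul_inv]
      exact mul_le_mul ((l2_opNorm_mul_le_of_le_one_left hS1 _).trans
        (l2_opNorm_mul_le_of_le_one_left hWW1 _)) hJ (norm_nonneg _) (norm_nonneg _)
    -- The factor 5 is `2 + 2` from the two terms in `T`, plus `1` from the term in `D`.
    rw [hdecomp]
    have := norm_add₃_le (a := -(Q * T)) (b := S * W * Tᵀ) (c := S * ((1 - W * Wᵀ) * D) * J)
    linarith

end Matrix

/-! ### From the exact to the computed SVD. -/

theorem IsReducedSVD.exists_mem_matrixSubdifferential_norm_sub_le {m n : ℕ}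
    {A D U : Matrix (Fin m) (Fin n) ℝ} {σ : Fin n → ℝ} {V : Matrix (Fin n) (Fin n) ℝ}
    (h : IsReducedSVD (A + D) U σ V) {η : ℝ} (hη : 0 < η)
    (hA : ∀ i : Fin n, matrixSingularValue A i ≠ 0 → η ≤ matrixSingularValue A i) :
    ∃ G ∈ matrixSubdifferential nuclearNorm A, ‖U * Vᵀ - G‖ ≤ 5 * (‖D‖ / η) := by
  have hV' : V * Vᵀ = 1 := mul_eq_one_comm.mp h.orthonormal_right
  refine Matrix.exists_mem_matrixSubdifferential_norm_sub_le (P := V * Matrix.diagonal σ * Vᵀ)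
    hη hA ?_ ?_ ?_ ?_
  · rw [Matrix.transpose_mul, Matrix.transpose_transpose, Matrix.mul_assoc, ← Matrix.mul_assoc Uᵀ,
      h.orthonormal_left, Matrix.one_mul, hV']
  · simp [Matrix.transpose_mul, Matrix.mul_assoc]
  · intro X i
    have := Matrix.diag_transpose_mul_diagonal_mul_nonneg h.nonneg (Vᵀ * X) i
    rw [Matrix.transpose_mul, Matrix.transpose_transpose] at this
    simpa only [Matrix.mul_assoc] using this
  · rw [h.eq]
    simp only [Matrix.mul_assoc]
    rw [← Matrix.mul_assoc Vᵀ V, h.orthonormal_right, Matrix.one_mul]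

theorem matrixSingularValue_eq_zero_of_rank_le {m n : ℕ} {A : Matrix (Fin m) (Fin n) ℝ} {i : ℕ}
    (h : A.rank ≤ i) : matrixSingularValue A i = 0 := by
  refine (LinearMap.singularValues_eq_zero_iff_le_finrank_range _).mpr ?_
  rwa [Matrix.rank_eq_finrank_range_toLin A (EuclideanSpace.basisFun (Fin m) ℝ).toBasis
    (EuclideanSpace.basisFun (Fin n) ℝ).toBasis, ← Matrix.toEuclideanLin_eq_toLin_orthonormal] at h

theorem norm_mul_transpose_sub_le {m n : ℕ} {U δU : Matrix (Fin m) (Fin n) ℝ}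
    {V δV : Matrix (Fin n) (Fin n) ℝ} {r : ℝ} (hU : ‖U + δU‖ ≤ 1) (hV : ‖V + δV‖ ≤ 1)
    (hδU : ‖δU‖ ≤ r) (hδV : ‖δV‖ ≤ r) :
    ‖U * Vᵀ - (U + δU) * (V + δV)ᵀ‖ ≤ 2 * r + r ^ 2 := by
  have h : U * Vᵀ - (U + δU) * (V + δV)ᵀ
      = -(δU * (V + δV)ᵀ) + -((U + δU) * δVᵀ) + δU * δVᵀ := by
    simp only [Matrix.transpose_add, Matrix.mul_add, Matrix.add_mul]
    abel
  have hr : 0 ≤ r := (norm_nonneg _).trans hδU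
  have n1 : ‖-(δU * (V + δV)ᵀ)‖ ≤ r := by
    rw [norm_neg]
    refine (Matrix.l2_opNorm_mul_le_of_le_one_right _ ?_).trans hδU
    rwa [Matrix.l2_opNorm_transpose]
  have n2 : ‖-((U + δU) * δVᵀ)‖ ≤ r := by
    rw [norm_neg]
    refine (Matrix.l2_opNorm_mul_le_of_le_one_left hU _).trans ?_
    rwa [Matrix.l2_opNorm_transpose]
  have n3 : ‖δU * δVᵀ‖ ≤ r ^ 2 := by
    refine (Matrix.l2_opNorm_mul _ _).trans ?_
    rw [Matrix.l2_opNorm_transpose, sq]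
    exact mul_le_mul hδU hδV (norm_nonneg _) hr
  rw [h]
  have := norm_add₃_le (a := -(δU * (V + δV)ᵀ)) (b := -((U + δU) * δVᵀ)) (c := δU * δVᵀ)
  linarith

theorem theorem3 (c K : ℝ) :
    ∃ C : ℝ, ∀ (m n s : ℕ) (A Uε : Matrix (Fin m) (Fin n) ℝ) (σε : Fin n → ℝ)
      (Vε : Matrix (Fin n) (Fin n) ℝ) (ε η : ℝ),
      0 < ε → ε ≤ 1 →
      IsBackwardStableSVD c ε A Uε σε Vε →
      A.rank = s →
      0 < η → η ≤ K →
      (∀ i < s, η ≤ matrixSingularValue A i) →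
      (matrixSubdifferential nuclearNorm A).Nonempty ∧
        Metric.infDist (Uε * Vεᵀ) (matrixSubdifferential nuclearNorm A) ≤ C * (ε / η) := by
  -- `5 * c` comes from `δA`. The errors `δU`, `δV` cost `2 * c * ε + (c * ε)² ≤ (2 * c + c²) * ε`,
  -- and `ε ≤ K * (ε / η)` because `η ≤ K`.
  refine ⟨5 * c + (2 * c + c ^ 2) * K, ?_⟩
  rintro m n s A Uε σε Vε ε η hε hε1 ⟨δU, δA, δV, hδU, hδV, hδA, hsvd⟩ hs hη hηK hσ
  have hc : 0 ≤ c := nonneg_of_mul_nonneg_left ((norm_nonneg _).trans hδA) hε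
  have hA : ∀ i : Fin n, matrixSingularValue A i ≠ 0 → η ≤ matrixSingularValue A i := by
    intro i hi
    refine hσ i (lt_of_not_ge fun h => hi ?_)
    exact matrixSingularValue_eq_zero_of_rank_le (hs.trans_le h)
  obtain ⟨G, hG, hGd⟩ := hsvd.exists_mem_matrixSubdifferential_norm_sub_le hη hA
  refine ⟨⟨G, hG⟩, (Metric.infDist_le_dist_of_mem hG).trans ?_⟩
  rw [dist_eq_norm]
  have h1 := norm_mul_transpose_sub_le
    (Matrix.l2_opNorm_le_one_of_transpose_mul_self hsvd.orthonormal_left)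
    (Matrix.l2_opNorm_le_one_of_transpose_mul_self hsvd.orthonormal_right) hδU hδV
  have h2 := norm_sub_le_norm_sub_add_norm_sub (Uε * Vεᵀ) ((Uε + δU) * (Vε + δV)ᵀ) G
  have h3 : ‖δA‖ / η ≤ c * (ε / η) := by
    rw [← mul_div_assoc]
    gcongr
  have h4 : ε ≤ K * (ε / η) := by
    rw [← mul_div_assoc, le_div_iff₀ hη, mul_comm]
    gcongr
  have h5 : (c * ε) ^ 2 ≤ c ^ 2 * ε := by
    rw [mul_pow]
    gcongr
    nlinarith
  have h6 : (2 * c + c ^ 2) * ε ≤ (2 * c + c ^ 2) * (K * (ε / η)) := by gcongr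
  linarith
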